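/- Let $\mathbb{D}$ be the open unit disc and $\mathbb{T}$ the unit circle in $\mathbb{C}$. Let $\widehat{\Theta}$ be the set of all diameters of $\mathbb{T}$ and all triangles with vertices on $\mathbb{T}$ that contain $0$ in their interior. Identify each $\vartheta\in\widehat{\Theta}$ with the unique Borel probability measure on $\mathbb{T}$ of mean zero (that is, $\int_{\mathbb{T}} w\,d\vartheta(w)=0$) supported on the endpoints of the diameter, respectively on the vertices of the triangle; the masses are the barycentric coordinates of $0$ with respect to these points. Give $\widehat{\Theta}$ the weak-* topology of measures and its Borel $\sigma$-algebra, and put \[ h_\vartheta(z)=\int_{\mathbb{T}}\frac{w+z}{w-z}\,d\vartheta(w)\qquad(z\in\mathbb{D}). \] Theorem (Herglotz--Agler representation). Let $f$ be an analytic function on $\mathbb{D}$ with positive real part, such that $f'(0)=0$ and $f(0)>0$ (in particular, $f(0)$ is real). Then there is a finite positive Borel measure $\nu$ on $\widehat{\Theta}$ such that, for every $z\in\mathbb{D}$, the function $\vartheta\mapsto h_\vartheta(z)$ is $\nu$-integrable and \[ f(z)=\int_{\widehat{\Theta}}h_\vartheta(z)\,d\nu(\vartheta). \] -/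

import Mathlib

open MeasureTheory
open scoped ComplexOrder

/-- The unit circle in the complex plane. -/
abbrev UnitCircle : Type := Metric.sphere (0 : ℂ) 1

/-- The endpoints of a diameter of the unit circle: an antipodal pair. -/
def IsDiameter (s : Finset UnitCircle) : Prop :=
  s.card = 2 ∧ ∀ a ∈ s, ∀ b ∈ s, a ≠ b → (b : ℂ) = -(a : ℂ)

/-- The vertices of a triangle inscribed in the unit circle that has the centre of the circle in
its interior. -/
def IsCentredTriangle (s : Finset UnitCircle) : Prop :=
  s.card = 3 ∧ (0 : ℂ) ∈ interior (convexHull ℝ ((fun w : UnitCircle => (w : ℂ)) '' (s : Set UnitCircle)))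

/-- The set `Θ̂` of diameters of the unit circle and of inscribed triangles with the centre in the
interior, each given by its set of vertices. -/
def ThetaHat : Type :=
  {s : Finset UnitCircle // IsDiameter s ∨ IsCentredTriangle s}

namespace ThetaHat

/-- The set of vertices (endpoints, for a diameter). -/
def vertices (ϑ : ThetaHat) : Finset UnitCircle := ϑ.1

theorem zero_mem_convexHull (ϑ : ThetaHat) :
    (0 : ℂ) ∈ convexHull ℝ ((fun w : UnitCircle => (w : ℂ)) '' (ϑ.vertices : Set UnitCircle)) := by
  obtain ⟨s, ⟨hc, h⟩ | ⟨hc, h⟩⟩ := ϑ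
  · classical
    obtain ⟨a, b, hab, rfl⟩ := Finset.card_eq_two.1 hc
    have hb : (b : ℂ) = -(a : ℂ) := h a (by simp) b (by simp) hab
    refine segment_subset_convexHull (x := (a : ℂ)) (y := (b : ℂ))
      (Set.mem_image_of_mem _ (by simp [vertices])) (Set.mem_image_of_mem _ (by simp [vertices]))
      ⟨1 / 2, 1 / 2, by norm_num, by norm_num, by norm_num, ?_⟩
    simp [hb]
  · exact interior_subset h

theorem affineIndependent (ϑ : ThetaHat) :
    AffineIndependent ℝ (fun w : ϑ.vertices => ((w : UnitCircle) : ℂ)) := by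
  have hinj : Function.Injective (fun w : ϑ.vertices => ((w : UnitCircle) : ℂ)) :=
    fun a b h => Subtype.ext (Subtype.ext h)
  have hcard : Fintype.card ϑ.vertices = 2 ∨ Fintype.card ϑ.vertices = 3 := by
    rw [Fintype.card_coe]
    rcases ϑ.2 with h | h
    · exact Or.inl h.1
    · exact Or.inr h.1
  have hco : EuclideanGeometry.Cospherical
      (Set.range (fun w : ϑ.vertices => ((w : UnitCircle) : ℂ))) := by
    refine ⟨0, 1, ?_⟩
    rintro _ ⟨w, rfl⟩
    simp
  rcases hcard with h | h
  · have e := Fintype.equivFinOfCardEq h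
    rw [← affineIndependent_equiv e.symm]
    have : ((fun w : ϑ.vertices => ((w : UnitCircle) : ℂ)) ∘ e.symm) =
        ![((e.symm 0 : UnitCircle) : ℂ), ((e.symm 1 : UnitCircle) : ℂ)] := by
      funext i; fin_cases i <;> rfl
    rw [this]
    refine affineIndependent_of_ne ℝ fun h01 => ?_
    have := e.symm.injective (hinj h01)
    exact absurd this (by decide)
  · have e := Fintype.equivFinOfCardEq h
    rw [← affineIndependent_equiv e.symm]
    refine hco.affineIndependent ?_ (hinj.comp e.symm.injective)
    rintro _ ⟨i, rfl⟩
    exact ⟨e.symm i, rfl⟩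

/-- The centre of the circle has exactly one system of barycentric coordinates with respect to the
vertices of an element of `Θ̂`. -/
theorem existsUnique_weight (ϑ : ThetaHat) :
    ∃! c : ϑ.vertices → ℝ, (∀ w, 0 ≤ c w) ∧ ∑ w, c w = 1 ∧
      ∑ w, (c w : ℂ) * ((w : UnitCircle) : ℂ) = 0 := by
  have h0 := ϑ.zero_mem_convexHull
  have himg : (fun w : UnitCircle => (w : ℂ)) '' (ϑ.vertices : Set UnitCircle) =
      Set.range (fun w : ϑ.vertices => ((w : UnitCircle) : ℂ)) := by
    ext x; simp
  rw [himg, convexHull_range_eq_exists_affineCombination] at h0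
  obtain ⟨t, c, hc0, hc1, hc⟩ := h0
  classical
  rw [Finset.affineCombination_eq_linear_combination _ _ _ hc1] at hc
  refine ⟨fun w => if w ∈ t then c w else 0, ⟨fun w => ?_, ?_, ?_⟩, ?_⟩
  · dsimp only
    split_ifs with hw
    · exact hc0 w hw
    · exact le_rfl
  · rw [Finset.sum_ite_mem, Finset.univ_inter, hc1]
  · refine Eq.trans ?_ hc
    simp only [← Complex.real_smul, ite_smul, zero_smul, Finset.sum_ite_mem, Finset.univ_inter]
  · rintro d ⟨-, hd1, hd⟩
    have h1 : ∑ w : ϑ.vertices, (if w ∈ t then c w else 0) = 1 := by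
      rw [Finset.sum_ite_mem, Finset.univ_inter, hc1]
    refine (affineIndependent_iff_eq_of_fintype_affineCombination_eq ℝ _).1 ϑ.affineIndependent
      d _ hd1 h1 ?_
    rw [Finset.affineCombination_eq_linear_combination _ _ _ hd1,
      Finset.affineCombination_eq_linear_combination _ _ _ h1]
    have h2 : ∑ w : ϑ.vertices, d w • ((w : UnitCircle) : ℂ) = 0 := by
      simpa [Complex.real_smul] using hd
    refine (h2.trans hc.symm).trans ?_
    simp only [ite_smul, zero_smul, Finset.sum_ite_mem, Finset.univ_inter]

/-- The barycentric coordinates of the centre with respect to the vertices. -/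
noncomputable def weight (ϑ : ThetaHat) : ϑ.vertices → ℝ :=
  ϑ.existsUnique_weight.choose

theorem weight_spec (ϑ : ThetaHat) :
    (∀ w, 0 ≤ ϑ.weight w) ∧ ∑ w, ϑ.weight w = 1 ∧
      ∑ w, (ϑ.weight w : ℂ) * ((w : UnitCircle) : ℂ) = 0 :=
  ϑ.existsUnique_weight.choose_spec.1

/-- The zero-mean probability measure on the circle carried by the vertices: the mass of a vertex
is the corresponding barycentric coordinate of the centre. -/
noncomputable def measure (ϑ : ThetaHat) : ProbabilityMeasure UnitCircle :=
  ⟨∑ w : ϑ.vertices, ENNReal.ofReal (ϑ.weight w) • Measure.dirac (w : UnitCircle), ⟨by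
    have h := ϑ.weight_spec
    simp only [Measure.finsetSum_apply, Measure.smul_apply, measure_univ, smul_eq_mul, mul_one]
    rw [← ENNReal.ofReal_sum_of_nonneg (fun w _ => h.1 w), h.2.1, ENNReal.ofReal_one]⟩⟩

/-- The topology on `Θ̂`: convergence in `Θ̂` is weak-* convergence of the associated measures. -/
noncomputable instance : TopologicalSpace ThetaHat :=
  TopologicalSpace.induced ThetaHat.measure inferInstance

noncomputable instance : MeasurableSpace ThetaHat := borel ThetaHat

instance : BorelSpace ThetaHat := ⟨rfl⟩

/-- The Herglotz transform `h_ϑ` of the measure associated with `ϑ`. -/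
noncomputable def herglotz (ϑ : ThetaHat) (z : ℂ) : ℂ :=
  ∫ w : UnitCircle, ((w : ℂ) + z) / ((w : ℂ) - z) ∂(ϑ.measure : Measure UnitCircle)

end ThetaHat

/-! Normalize to f(0) = 1. Then f is the Herglotz transform of a probability measure on the circle,
and f'(0) = 0 makes its mean zero. Mean zero amounts to two real linear equations, so extreme
zero-mean probability measures live on at most three points; these are the elements of Θ̂, and f
should be a mixture of their transforms.

The mixture is found by compactness. For finite Z in the disc, the values of f on Z lie in the
convex hull of the vectors (h_ϑ(z)), z ∈ Z. For functions analytic on the closed disc this is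
`integral_mem_convexHull_range`, applied to the density Re f on the circle; Carathéodory reduces it
to finitely many points and Krein–Milman to at most three. Dilations f(r·) with r → 1 give the
general case, because the hull is closed.

Θ̂ is compact, since zero-mean measures on at most three points form a closed family
(`range_measure`). Hence the probability measures on Θ̂ form a compact space, and the finite
intersection property yields one ν for all z (`exists_probabilityMeasure_integral_herglotz_eq`). -/

/-! ### Finite convex combinations -/

/-- Padding with zero weights changes no weighted sum, wherever the added points lie. The general
`G` covers scalars, vectors and measures. -/
theorem Fintype.sum_extend {ι κ X M : Type*} [Fintype ι] [Fintype κ] [AddCommMonoid M]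
    (e : ι ↪ κ) (c : ι → ℝ) (x : ι → X) (x₀ : κ → X) (G : ℝ → X → M) (hG : ∀ y, G 0 y = 0) :
    ∑ k, G (Function.extend e c 0 k) (Function.extend e x x₀ k) = ∑ i, G (c i) (x i) := by
  classical
  rw [← Finset.sum_subset (Finset.subset_univ (Finset.univ.map e))]
  · simp [Finset.sum_map, e.injective.extend_apply]
  · intro k _ hk
    have : ¬ ∃ i, e i = k := by simpa using hk
    simp [Function.extend_apply' _ _ _ this, hG]

theorem extend_mem_stdSimplex {ι κ : Type*} [Fintype ι] [Fintype κ] (e : ι ↪ κ) {c : ι → ℝ}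
    (hc : c ∈ stdSimplex ℝ ι) : Function.extend e c 0 ∈ stdSimplex ℝ κ := by
  classical
  refine ⟨fun k => ?_, ?_⟩
  · by_cases hk : ∃ i, e i = k
    · obtain ⟨i, rfl⟩ := hk
      rw [e.injective.extend_apply]
      exact hc.1 i
    · simp [Function.extend_apply' _ _ _ hk]
  · have := Fintype.sum_extend e c (fun _ => ()) (fun _ => ()) (fun t _ => t) fun _ => rfl
    simpa [hc.2] using this

/-- In a finite-dimensional space the convex hull of a compact set is compact. -/
theorem IsCompact.convexHull_of_finiteDimensional {V : Type*} [NormedAddCommGroup V]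
    [NormedSpace ℝ V] [FiniteDimensional ℝ V] {s : Set V} (hs : IsCompact s) :
    IsCompact (convexHull ℝ s) := by
  obtain rfl | ⟨x₀, hx₀⟩ := s.eq_empty_or_nonempty
  · simp
  -- Carathéodory's bound: with this fixed number of points, the hull is a continuous image of a
  -- compact product.
  let κ := Fin (Module.finrank ℝ V + 1)
  have hK : IsCompact ((stdSimplex ℝ κ) ×ˢ (Set.univ.pi fun _ : κ => s)) :=
    (isCompact_stdSimplex ℝ κ).prod (isCompact_univ_pi fun _ => hs)
  convert hK.image (f := fun p : (κ → ℝ) × (κ → V) => ∑ k, p.1 k • p.2 k) (by fun_prop)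
  ext x
  constructor
  · intro hx
    obtain ⟨ι, _, z, w, hz, hind, hw, hw1, rfl⟩ := eq_pos_convex_span_of_mem_convexHull hx
    have hcard : Fintype.card ι ≤ Fintype.card κ := by
      simpa [κ] using hind.card_le_finrank_succ.trans
        (Nat.add_le_add_right (Submodule.finrank_le _) 1)
    obtain ⟨e⟩ := Function.Embedding.nonempty_of_card_le hcard
    refine ⟨(Function.extend e w 0, Function.extend e z fun _ => x₀), ⟨?_, fun k _ => ?_⟩,
      Fintype.sum_extend e w z (fun _ => x₀) (fun t y => t • y) (zero_smul ℝ)⟩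
    · exact extend_mem_stdSimplex e ⟨fun i => (hw i).le, hw1⟩
    · by_cases hk : ∃ i, e i = k
      · obtain ⟨i, rfl⟩ := hk
        simpa [e.injective.extend_apply] using hz ⟨i, rfl⟩
      · simpa [Function.extend_apply' _ _ _ hk] using hx₀
  · rintro ⟨⟨c, y⟩, ⟨hc, hy⟩, rfl⟩
    exact (convex_convexHull ℝ s).sum_mem (fun k _ => hc.1 k) hc.2
      fun k _ => subset_convexHull ℝ s (hy k trivial)

/-! ### Finitely supported probability measures -/

namespace MeasureTheory.ProbabilityMeasure

/-- The probability measure with mass `c i` at `x i`. -/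
noncomputable def ofWeights {ι X : Type*} [Fintype ι] [MeasurableSpace X] (c : stdSimplex ℝ ι)
    (x : ι → X) : ProbabilityMeasure X :=
  ⟨∑ i, ENNReal.ofReal (c.1 i) • Measure.dirac (x i), ⟨by
    simp only [Measure.finsetSum_apply, Measure.smul_apply, measure_univ, smul_eq_mul, mul_one]
    rw [← ENNReal.ofReal_sum_of_nonneg (fun i _ => c.2.1 i), c.2.2, ENNReal.ofReal_one]⟩⟩

theorem integral_ofWeights {ι X V : Type*} [Fintype ι] [MeasurableSpace X] [NormedAddCommGroup V]
    [NormedSpace ℝ V] [CompleteSpace V] (c : stdSimplex ℝ ι) (x : ι → X) {F : X → V}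
    (hF : StronglyMeasurable F) :
    ∫ y, F y ∂(ofWeights c x : Measure X) = ∑ i, c.1 i • F (x i) := by
  have : (ofWeights c x : Measure X) = ∑ i, ENNReal.ofReal (c.1 i) • Measure.dirac (x i) := rfl
  rw [this, integral_finsetSum_measure]
  · refine Finset.sum_congr rfl fun i _ => ?_
    rw [integral_smul_measure, integral_dirac' _ _ hF, ENNReal.toReal_ofReal (c.2.1 i)]
  · intro i _
    exact (integrable_dirac' hF (by simp)).smul_measure ENNReal.ofReal_ne_top

/-- Against a test function the measure gives a finite sum, jointly continuous in weights and
points. -/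
theorem continuous_ofWeights {ι X : Type*} [Fintype ι] [TopologicalSpace X] [MeasurableSpace X]
    [OpensMeasurableSpace X] :
    Continuous fun p : stdSimplex ℝ ι × (ι → X) => ofWeights p.1 p.2 := by
  refine continuous_iff_continuousAt.2 fun p => ?_
  refine ProbabilityMeasure.tendsto_iff_forall_integral_tendsto.2 fun g => ?_
  have hg : StronglyMeasurable g := g.continuous.measurable.stronglyMeasurable
  simp only [integral_ofWeights _ _ hg]
  have : Continuous fun p : stdSimplex ℝ ι × (ι → X) => ∑ i, p.1.1 i • g (p.2 i) := by
    refine continuous_finsetSum _ fun i _ => ?_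
    exact ((continuous_apply i).comp (continuous_subtype_val.comp continuous_fst)).smul
      (g.continuous.comp ((continuous_apply i).comp continuous_snd))
  exact this.tendsto p

end MeasureTheory.ProbabilityMeasure

/-! ### Barycentric coordinates and compactness of Θ̂ -/

theorem AffineIndependent.sum_smul_mem_interior_convexHull_iff {ι V : Type*} [Fintype ι]
    [NormedAddCommGroup V] [NormedSpace ℝ V] [FiniteDimensional ℝ V] {x : ι → V}
    (hx : AffineIndependent ℝ x) (hcard : Fintype.card ι = Module.finrank ℝ V + 1) {c : ι → ℝ}
    (hc : ∑ i, c i = 1) :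
    ∑ i, c i • x i ∈ interior (convexHull ℝ (Set.range x)) ↔ ∀ i, 0 < c i := by
  let b : AffineBasis ι ℝ V := ⟨x, hx, hx.affineSpan_eq_top_iff_card_eq_finrank_add_one.2 hcard⟩
  have hb : interior (convexHull ℝ (Set.range x)) = _ := b.interior_convexHull
  have hsum : ∑ i, c i • x i = Finset.univ.affineCombination ℝ b c :=
    (Finset.affineCombination_eq_linear_combination _ _ _ hc).symm
  rw [hb, hsum]
  refine forall_congr' fun i => ?_
  rw [b.coord_apply_combination_of_mem (Finset.mem_univ i) hc]

namespace ThetaHat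

theorem affineIndependent_coe_of_card_eq_three {s : Finset UnitCircle} (hs : s.card = 3) :
    AffineIndependent ℝ (fun w : s => ((w : UnitCircle) : ℂ)) := by
  have hinj : Function.Injective (fun w : s => ((w : UnitCircle) : ℂ)) :=
    fun a b h => Subtype.ext (Subtype.ext h)
  have e := Fintype.equivFinOfCardEq (show Fintype.card s = 3 by simpa using hs)
  rw [← affineIndependent_equiv e.symm]
  have hco : EuclideanGeometry.Cospherical
      (Set.range (fun w : s => ((w : UnitCircle) : ℂ))) := by
    refine ⟨0, 1, ?_⟩
    rintro _ ⟨w, rfl⟩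
    simp
  refine hco.affineIndependent ?_ (hinj.comp e.symm.injective)
  rintro _ ⟨i, rfl⟩
  exact ⟨e.symm i, rfl⟩

theorem zero_mem_interior_convexHull_iff {s : Finset UnitCircle} (hs : s.card = 3) {c : s → ℝ}
    (h1 : ∑ w, c w = 1) (h0 : ∑ w, (c w : ℂ) * ((w : UnitCircle) : ℂ) = 0) :
    (0 : ℂ) ∈ interior (convexHull ℝ ((fun w : UnitCircle => (w : ℂ)) '' (s : Set UnitCircle))) ↔
      ∀ w, 0 < c w := by
  have himg : (fun w : UnitCircle => (w : ℂ)) '' (s : Set UnitCircle) =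
      Set.range (fun w : s => ((w : UnitCircle) : ℂ)) := by
    ext x; simp
  have hsum : ∑ w, c w • ((w : UnitCircle) : ℂ) = 0 := by simpa [Complex.real_smul] using h0
  rw [himg, ← (affineIndependent_coe_of_card_eq_three hs).sum_smul_mem_interior_convexHull_iff
    (by simpa [Complex.finrank_real_complex] using hs) h1, hsum]

/-- If one endpoint of a diameter had mass zero, the other would carry everything and the mean would
have modulus one. Positivity makes the vertices exactly the atoms, so the measure determines ϑ. -/
theorem weight_pos (ϑ : ThetaHat) (w : ϑ.vertices) : 0 < ϑ.weight w := by
  obtain ⟨hn, h1, h0⟩ := ϑ.weight_spec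
  rcases ϑ.2 with h | h
  · classical
    refine (hn w).lt_of_ne fun hw => ?_
    have hcard : (Finset.univ.erase w).card = 1 := by
      rw [Finset.card_erase_of_mem (Finset.mem_univ w), Finset.card_univ, Fintype.card_coe]
      have : ϑ.vertices.card = 2 := h.1
      omega
    obtain ⟨v, hv⟩ := Finset.card_eq_one.1 hcard
    rw [← Finset.add_sum_erase _ _ (Finset.mem_univ w), hv, ← hw, Finset.sum_singleton,
      zero_add] at h1
    rw [← Finset.add_sum_erase _ _ (Finset.mem_univ w), hv, ← hw, Finset.sum_singleton, h1] at h0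
    have hv0 : ((v : UnitCircle) : ℂ) = 0 := by simpa using h0
    have hv1 : ‖((v : UnitCircle) : ℂ)‖ = 1 := by simp
    simp [hv0] at hv1
  · exact (zero_mem_interior_convexHull_iff h.1 h1 h0).1 h.2 w

theorem weight_eq (ϑ : ThetaHat) {c : ϑ.vertices → ℝ} (hn : ∀ w, 0 ≤ c w) (h1 : ∑ w, c w = 1)
    (h0 : ∑ w, (c w : ℂ) * ((w : UnitCircle) : ℂ) = 0) : ϑ.weight = c :=
  ϑ.existsUnique_weight.unique ϑ.weight_spec ⟨hn, h1, h0⟩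

theorem measure_eq_ofWeights (ϑ : ThetaHat) :
    ϑ.measure = ProbabilityMeasure.ofWeights
      ⟨ϑ.weight, ϑ.weight_spec.1, ϑ.weight_spec.2.1⟩ (fun w : ϑ.vertices => (w : UnitCircle)) :=
  rfl

theorem integral_measure {V : Type*} [NormedAddCommGroup V] [NormedSpace ℝ V] [CompleteSpace V]
    (ϑ : ThetaHat) {F : UnitCircle → V} (hF : StronglyMeasurable F) :
    ∫ u, F u ∂(ϑ.measure : Measure UnitCircle) = ∑ w, ϑ.weight w • F w := by
  rw [measure_eq_ofWeights, ProbabilityMeasure.integral_ofWeights _ _ hF]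

theorem mem_vertices_iff (ϑ : ThetaHat) (u : UnitCircle) :
    u ∈ ϑ.vertices ↔ (ϑ.measure : Measure UnitCircle) {u} ≠ 0 := by
  have : (ϑ.measure : Measure UnitCircle) {u} = ∑ w : ϑ.vertices,
      ENNReal.ofReal (ϑ.weight w) * Set.indicator {u} 1 (w : UnitCircle) := by
    change (∑ w : ϑ.vertices, ENNReal.ofReal (ϑ.weight w) • Measure.dirac (w : UnitCircle)) {u} = _
    simp [Measure.finsetSum_apply]
  rw [this, Ne, Finset.sum_eq_zero_iff]
  constructor
  · intro hu h
    have := h ⟨u, hu⟩ (Finset.mem_univ _)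
    simp [(ϑ.weight_pos ⟨u, hu⟩).not_ge] at this
  · contrapose!
    rintro hu ⟨w, hw⟩ -
    have : w ≠ u := fun h => hu (h ▸ hw)
    simp [this]

theorem measure_injective : Function.Injective ThetaHat.measure := fun ϑ ϑ' h =>
  Subtype.ext <| Finset.ext fun u => by
    change u ∈ ϑ.vertices ↔ u ∈ ϑ'.vertices
    rw [mem_vertices_iff, mem_vertices_iff, h]

theorem isEmbedding_measure : Topology.IsEmbedding ThetaHat.measure :=
  ⟨⟨rfl⟩, measure_injective⟩

instance : TopologicalSpace.MetrizableSpace ThetaHat := isEmbedding_measure.metrizableSpace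

/-- A single point has mean of modulus one. For two points, comparing moduli in the mean equation
forces equal masses, hence antipodal points. For three, positive barycentric coordinates mean
interior. -/
theorem isDiameter_or_isCentredTriangle {s : Finset UnitCircle} (hs : s.card ≤ 3)
    {c : UnitCircle → ℝ} (hc : ∀ w ∈ s, 0 < c w) (h1 : ∑ w ∈ s, c w = 1)
    (h0 : ∑ w ∈ s, (c w : ℂ) * (w : ℂ) = 0) : IsDiameter s ∨ IsCentredTriangle s := by
  classical
  have hcases : s.card = 0 ∨ s.card = 1 ∨ s.card = 2 ∨ s.card = 3 := by omega
  rcases hcases with h | h | h | h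
  · rw [Finset.card_eq_zero.1 h] at h1
    simp at h1
  · obtain ⟨v, rfl⟩ := Finset.card_eq_one.1 h
    have hv1 : ‖(v : ℂ)‖ = 1 := by simp
    simp only [Finset.sum_singleton] at h1 h0
    have hv0 : (v : ℂ) = 0 := by simpa [h1] using h0
    simp [hv0] at hv1
  · refine Or.inl ⟨h, ?_⟩
    obtain ⟨a, b, hab, rfl⟩ := Finset.card_eq_two.1 h
    rw [Finset.sum_pair hab] at h1 h0
    have ha : 0 < c a := hc a (by simp)
    have hb : 0 < c b := hc b (by simp)
    have hn : ‖(c a : ℂ) * (a : ℂ)‖ = ‖(c b : ℂ) * (b : ℂ)‖ := by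
      rw [eq_neg_of_add_eq_zero_left h0, norm_neg]
    have hcc : c a = c b := by simpa [abs_of_pos ha, abs_of_pos hb] using hn
    have hba : (b : ℂ) = -(a : ℂ) := by
      rw [hcc, ← mul_add] at h0
      have := (mul_eq_zero.1 h0).resolve_left (by exact_mod_cast hb.ne')
      linear_combination this
    intro x hx y hy hxy
    simp only [Finset.mem_insert, Finset.mem_singleton] at hx hy
    rcases hx with rfl | rfl <;> rcases hy with rfl | rfl
    · exact absurd rfl hxy
    · exact hba
    · rw [hba, neg_neg]
    · exact absurd rfl hxy
  · refine Or.inr ⟨h, (zero_mem_interior_convexHull_iff h (c := fun w => c w) ?_ ?_).2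
      fun w => hc w w.2⟩
    · exact (Finset.sum_coe_sort s c).trans h1
    · exact (Finset.sum_coe_sort s fun w => (c w : ℂ) * (w : ℂ)).trans h0

/-- A zero-mean probability measure carried by at most three points of the circle belongs to an
element of `Θ̂`. -/
theorem exists_measure_eq_ofWeights {ι : Type*} [Fintype ι] (hι : Fintype.card ι ≤ 3)
    (c : stdSimplex ℝ ι) (x : ι → UnitCircle) (h0 : ∑ i, (c.1 i : ℂ) * (x i : ℂ) = 0) :
    ∃ ϑ : ThetaHat, ϑ.measure = ProbabilityMeasure.ofWeights c x := by
  classical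
  -- The `x i` may coincide and weights may vanish: masses are collected at each point, and null
  -- points are discarded.
  let C : UnitCircle → ℝ := fun u => ∑ i with x i = u, c.1 i
  have hC : ∀ u, 0 ≤ C u := fun u => Finset.sum_nonneg fun i _ => c.2.1 i
  let s : Finset UnitCircle := (Finset.univ.image x).filter fun u => 0 < C u
  have hs : s.card ≤ 3 :=
    (Finset.card_filter_le _ _).trans (Finset.card_image_le.trans (by simpa using hι))
  -- The same regrouping serves the total mass, the mean and the measure itself.
  have hsum : ∀ {M : Type} [AddCommMonoid M] (F : UnitCircle → M) (G : ι → M),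
      (∀ u, F u = ∑ i with x i = u, G i) → (∀ u, C u = 0 → F u = 0) →
        ∑ u ∈ s, F u = ∑ i, G i := by
    intro M _ F G hF hF0
    rw [Finset.sum_filter_of_ne, ← Finset.sum_fiberwise_of_maps_to (g := x)
      (t := Finset.univ.image x) fun i _ => Finset.mem_image_of_mem x (Finset.mem_univ i)]
    · exact Finset.sum_congr rfl fun u _ => hF u
    · intro u _ hu
      exact (hC u).lt_of_ne fun h => hu (hF0 u h.symm)
  have h1s : ∑ u ∈ s, C u = 1 := (hsum C c.1 (fun u => rfl) fun u hu => hu).trans c.2.2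
  have h0s : ∑ u ∈ s, (C u : ℂ) * (u : ℂ) = 0 := by
    refine (hsum (fun u => (C u : ℂ) * (u : ℂ)) (fun i => (c.1 i : ℂ) * (x i : ℂ)) (fun u => ?_)
      fun u hu => by simp [hu]).trans h0
    simp only [C]
    push_cast
    rw [Finset.sum_mul]
    exact Finset.sum_congr rfl fun i hi => by rw [(Finset.mem_filter.1 hi).2]
  let ϑ : ThetaHat := ⟨s, isDiameter_or_isCentredTriangle hs
    (fun w hw => (Finset.mem_filter.1 hw).2) h1s h0s⟩
  have hw : ϑ.weight = fun w : s => C w := by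
    refine ϑ.weight_eq (fun w => hC _) ?_ ?_
    · exact (Finset.sum_coe_sort s C).trans h1s
    · exact (Finset.sum_coe_sort s fun w => (C w : ℂ) * (w : ℂ)).trans h0s
  refine ⟨ϑ, Subtype.ext ?_⟩
  change (∑ w : s, ENNReal.ofReal (ϑ.weight w) • Measure.dirac (w : UnitCircle)) =
    ∑ i, ENNReal.ofReal (c.1 i) • Measure.dirac (x i)
  rw [hw]
  refine (Finset.sum_coe_sort s fun w => ENNReal.ofReal (C w) • Measure.dirac w).trans ?_
  refine hsum (fun w => ENNReal.ofReal (C w) • Measure.dirac w) _ (fun u => ?_)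
    fun u hu => by simp [hu]
  rw [ENNReal.ofReal_sum_of_nonneg fun i _ => c.2.1 i, Finset.sum_smul]
  exact Finset.sum_congr rfl fun i hi => by rw [(Finset.mem_filter.1 hi).2]

/-- Allowing repeated points and zero weights removes the open conditions that define Θ̂; only the
closed mean-zero equation remains, on a compact parameter space. -/
theorem range_measure : Set.range ThetaHat.measure =
    (fun p : stdSimplex ℝ (Fin 3) × (Fin 3 → UnitCircle) => ProbabilityMeasure.ofWeights p.1 p.2) ''
      {p | ∑ i, (p.1.1 i : ℂ) * (p.2 i : ℂ) = 0} := by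
  ext μ
  constructor
  · rintro ⟨ϑ, rfl⟩
    have hcard : Fintype.card ϑ.vertices ≤ Fintype.card (Fin 3) := by
      rw [Fintype.card_coe, Fintype.card_fin]
      rcases ϑ.2 with h | h
      · exact h.1.trans_le (by norm_num)
      · exact h.1.le
    obtain ⟨e⟩ := Function.Embedding.nonempty_of_card_le hcard
    have hw : ϑ.weight ∈ stdSimplex ℝ ϑ.vertices := ⟨ϑ.weight_spec.1, ϑ.weight_spec.2.1⟩
    let x : ϑ.vertices → UnitCircle := fun w => w
    let x₀ : Fin 3 → UnitCircle := fun _ => ⟨1, by simp⟩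
    refine ⟨(⟨_, extend_mem_stdSimplex e hw⟩, Function.extend e x x₀), ?_, ?_⟩
    · exact (Fintype.sum_extend e ϑ.weight x x₀ (fun t u => (t : ℂ) * (u : ℂ))
        (by simp)).trans ϑ.weight_spec.2.2
    · exact Subtype.ext (Fintype.sum_extend e ϑ.weight x x₀
        (fun t u => ENNReal.ofReal t • Measure.dirac u) (by simp))
  · rintro ⟨⟨c, x⟩, h0, rfl⟩
    exact exists_measure_eq_ofWeights (by simp) c x h0

instance : CompactSpace ThetaHat := by
  rw [← isCompact_univ_iff, isEmbedding_measure.isCompact_iff, Set.image_univ, range_measure]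
  refine IsCompact.image (IsClosed.isCompact ?_) ProbabilityMeasure.continuous_ofWeights
  refine isClosed_eq (continuous_finsetSum _ fun i _ => ?_) continuous_const
  exact (Complex.continuous_ofReal.comp
    ((continuous_apply i).comp (continuous_subtype_val.comp continuous_fst))).mul
    (continuous_subtype_val.comp ((continuous_apply i).comp continuous_snd))

end ThetaHat

/-! ### Extreme points of a simplex cut by linear equations -/

theorem Fintype.sum_subtype_of_eq_zero {ι M : Type*} [Fintype ι] [AddCommMonoid M] (p : ι → Prop)
    [DecidablePred p] (F : ι → M) (hF : ∀ i, ¬ p i → F i = 0) :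
    ∑ i : {i // p i}, F i = ∑ i, F i := by
  rw [← Finset.sum_filter_of_ne fun i _ hi => not_not.1 fun h => hi (hF i h)]
  exact (Finset.sum_subtype _ (by simp) F).symm

/-- An extreme point of the set of points of the standard simplex that satisfy a system of `d`
real linear equations has at most `d + 1` nonzero coordinates. -/
theorem card_pos_le_of_mem_extremePoints {ι V : Type*} [Fintype ι] [AddCommGroup V] [Module ℝ V]
    [FiniteDimensional ℝ V] (v : ι → V) {c : ι → ℝ}
    (hc : c ∈ Set.extremePoints ℝ {c | c ∈ stdSimplex ℝ ι ∧ ∑ i, c i • v i = 0})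
    [Fintype {i // 0 < c i}] :
    Fintype.card {i // 0 < c i} ≤ Module.finrank ℝ V + 1 := by
  classical
  obtain ⟨⟨⟨hn, h1⟩, h0⟩, hext⟩ := hc
  by_contra! hcard
  -- The extra coordinate 1 records total mass, so a kernel vector perturbs the weights without
  -- changing either constraint.
  let A : ({i // 0 < c i} → ℝ) →ₗ[ℝ] V × ℝ :=
    (Fintype.linearCombination ℝ fun i : {i // 0 < c i} => (v i, (1 : ℝ)))
  have hA : A.ker ≠ ⊥ := LinearMap.ker_ne_bot_of_finrank_lt (by simpa using hcard)
  obtain ⟨d, hd, hd0⟩ := A.ker.ne_bot_iff.1 hA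
  have hd' : ∑ i, d i • (v i, (1 : ℝ)) = 0 := by
    simpa [A, Fintype.linearCombination_apply] using hd
  have hdv : ∑ i, d i • v i = 0 := by simpa [Prod.fst_sum] using congrArg Prod.fst hd'
  have hd1 : ∑ i, d i = 0 := by simpa [Prod.snd_sum] using congrArg Prod.snd hd'
  let D : ι → ℝ := fun i => if h : 0 < c i then d ⟨i, h⟩ else 0
  have hDd : ∀ i : {i // 0 < c i}, D i = d i := fun i => dif_pos i.2
  have hDn : ∀ i, ¬ 0 < c i → D i = 0 := fun i h => dif_neg h
  have hDv : ∑ i, D i • v i = 0 := by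
    rw [← Fintype.sum_subtype_of_eq_zero (fun i => 0 < c i) _ fun i h => by simp [hDn i h]]
    simp only [hDd]
    convert hdv
  have hD1 : ∑ i, D i = 0 := by
    rw [← Fintype.sum_subtype_of_eq_zero (fun i => 0 < c i) _ hDn]
    simp only [hDd]
    convert hd1
  -- `D` vanishes off the support of `c`, so c ± tD stays nonnegative for small t > 0, and `c` is
  -- the midpoint of the two.
  have hev : ∀ᶠ t : ℝ in nhdsWithin 0 (Set.Ioi 0), ∀ i, 0 ≤ c i + t * D i ∧ 0 ≤ c i - t * D i := by
    refine nhdsWithin_le_nhds (Filter.eventually_all.2 fun i => ?_)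
    by_cases hi : 0 < c i
    · have hp : Filter.Tendsto (fun t : ℝ => c i + t * D i) (nhds 0) (nhds (c i)) := by
        have : Continuous fun t : ℝ => c i + t * D i := by fun_prop
        simpa using this.tendsto 0
      have hm : Filter.Tendsto (fun t : ℝ => c i - t * D i) (nhds 0) (nhds (c i)) := by
        have : Continuous fun t : ℝ => c i - t * D i := by fun_prop
        simpa using this.tendsto 0
      filter_upwards [hp.eventually (lt_mem_nhds hi), hm.eventually (lt_mem_nhds hi)] with t h1 h2
      exact ⟨h1.le, h2.le⟩
    · exact Filter.Eventually.of_forall fun t => by simp [hDn i hi, hn i]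
  obtain ⟨t, ht, htpos⟩ := (hev.and self_mem_nhdsWithin).exists
  have hmem : ∀ s : ℝ, (∀ i, 0 ≤ c i + s * D i) →
      c + s • D ∈ {c | c ∈ stdSimplex ℝ ι ∧ ∑ i, c i • v i = 0} := by
    refine fun s hs => ⟨⟨hs, ?_⟩, ?_⟩
    · simp [Finset.sum_add_distrib, ← Finset.mul_sum, h1, hD1]
    · simp [add_smul, mul_smul, Finset.sum_add_distrib, ← Finset.smul_sum, h0, hDv]
  have heq := hext (hmem t fun i => (ht i).1)
    (hmem (-t) fun i => by simpa [sub_eq_add_neg] using (ht i).2)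
    ⟨1 / 2, 1 / 2, by norm_num, by norm_num, by norm_num, by module⟩
  refine hd0 (funext fun i => ?_)
  have hi := congrFun heq i
  have htpos' : 0 < t := htpos
  simpa [htpos'.ne', hDd] using hi

/-! ### Integrals of continuous functions on compact spaces -/

theorem Continuous.integrable_comp_of_compactSpace {Ω X V : Type*} [MeasurableSpace Ω]
    {P : Measure Ω} [IsFiniteMeasure P] [TopologicalSpace X] [CompactSpace X] [MeasurableSpace X]
    [OpensMeasurableSpace X] [TopologicalSpace.PseudoMetrizableSpace X] [NormedAddCommGroup V]
    {F : X → V} (hF : Continuous F)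
    {g : Ω → X} (hg : Measurable g) : Integrable (fun ω => F (g ω)) P := by
  obtain ⟨C, hC⟩ := (isCompact_range hF).isBounded.exists_norm_le
  refine Integrable.of_bound (hF.stronglyMeasurable.comp_measurable hg).aestronglyMeasurable C
    (Filter.Eventually.of_forall fun ω => hC _ ⟨g ω, rfl⟩)

namespace MeasureTheory.ProbabilityMeasure

theorem continuous_integral {X V : Type*} [TopologicalSpace X] [CompactSpace X]
    [MeasurableSpace X] [OpensMeasurableSpace X] [TopologicalSpace.PseudoMetrizableSpace X]
    [NormedAddCommGroup V] [NormedSpace ℝ V] [FiniteDimensional ℝ V] {F : X → V}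
    (hF : Continuous F) :
    Continuous fun μ : ProbabilityMeasure X => ∫ x, F x ∂(μ : Measure X) := by
  have : CompleteSpace V := FiniteDimensional.complete ℝ V
  let e := (Module.finBasis ℝ V).equivFunL
  rw [← e.toHomeomorph.comp_continuous_iff]
  refine _root_.continuous_pi fun i => ?_
  let l : V →L[ℝ] ℝ := (ContinuousLinearMap.proj (R := ℝ)
    (φ := fun _ : Fin (Module.finrank ℝ V) => ℝ) i).comp e.toContinuousLinearMap
  have hl : ∀ μ : ProbabilityMeasure X, l (∫ x, F x ∂(μ : Measure X)) =
      ∫ x, l (F x) ∂(μ : Measure X) := fun μ =>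
    (l.integral_comp_comm (hF.integrable_comp_of_compactSpace measurable_id)).symm
  change Continuous fun μ : ProbabilityMeasure X => l (∫ x, F x ∂(μ : Measure X))
  simp only [hl]
  refine continuous_iff_continuousAt.2 fun μ => ?_
  exact ProbabilityMeasure.tendsto_iff_forall_integral_tendsto.1 Filter.tendsto_id
    (BoundedContinuousFunction.mkOfCompact ⟨fun x => l (F x), l.continuous.comp hF⟩)

end MeasureTheory.ProbabilityMeasure

/-! ### Zero-mean integrals as convex combinations over Θ̂ -/

namespace ThetaHat

variable {V : Type*} [NormedAddCommGroup V] [NormedSpace ℝ V] [FiniteDimensional ℝ V]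

theorem continuous_integral_measure {F : UnitCircle → V} (hF : Continuous F) :
    Continuous fun ϑ : ThetaHat => ∫ u, F u ∂(ϑ.measure : Measure UnitCircle) :=
  (ProbabilityMeasure.continuous_integral hF).comp isEmbedding_measure.continuous

theorem isCompact_convexHull_range {F : UnitCircle → V} (hF : Continuous F) :
    IsCompact (convexHull ℝ
      (Set.range fun ϑ : ThetaHat => ∫ u, F u ∂(ϑ.measure : Measure UnitCircle))) :=
  (isCompact_range (continuous_integral_measure hF)).convexHull_of_finiteDimensional

/-- With the points fixed, the admissible weights form a compact convex set whose extreme points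
have at most 2 + 1 nonzero coordinates and so come from Θ̂. Krein–Milman and closedness of the
target hull do the rest. -/
theorem sum_smul_mem_convexHull_range {ι : Type*} [Fintype ι] {F : UnitCircle → V}
    (hF : Continuous F) (c : stdSimplex ℝ ι) (x : ι → UnitCircle)
    (h0 : ∑ i, c.1 i • (x i : ℂ) = 0) :
    ∑ i, c.1 i • F (x i) ∈ convexHull ℝ
      (Set.range fun ϑ : ThetaHat => ∫ u, F u ∂(ϑ.measure : Measure UnitCircle)) := by
  classical
  have : CompleteSpace V := FiniteDimensional.complete ℝ V
  set K := convexHull ℝ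
    (Set.range fun ϑ : ThetaHat => ∫ u, F u ∂(ϑ.measure : Measure UnitCircle)) with hK
  let P : Set (ι → ℝ) := {c | c ∈ stdSimplex ℝ ι ∧ ∑ i, c i • (x i : ℂ) = 0}
  have hPc : IsCompact P := (isCompact_stdSimplex ℝ ι).inter_right
    (isClosed_eq (by fun_prop) continuous_const)
  let A : (ι → ℝ) →ₗ[ℝ] ℂ := Fintype.linearCombination ℝ fun i => (x i : ℂ)
  let B : (ι → ℝ) →ₗ[ℝ] V := Fintype.linearCombination ℝ fun i => F (x i)
  have hPconv : Convex ℝ P := (convex_stdSimplex ℝ ι).inter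
    ((convex_singleton (0 : ℂ)).linear_preimage A)
  have hext : P.extremePoints ℝ ⊆ B ⁻¹' K := by
    intro a ha
    have hcard := card_pos_le_of_mem_extremePoints (fun i => (x i : ℂ)) ha
    rw [Complex.finrank_real_complex] at hcard
    obtain ⟨⟨hn, h1⟩, h0⟩ := ha.1
    have hzero : ∀ i, ¬ 0 < a i → a i = 0 := fun i hi => le_antisymm (not_lt.1 hi) (hn i)
    obtain ⟨ϑ, hϑ⟩ := exists_measure_eq_ofWeights (ι := {i // 0 < a i}) hcard
      ⟨fun i => a i, fun i => hn i, by
        rw [Fintype.sum_subtype_of_eq_zero (fun i => 0 < a i) a hzero, h1]⟩ (fun i => x i) (by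
        rw [Fintype.sum_subtype_of_eq_zero (fun i => 0 < a i) (fun i => (a i : ℂ) * (x i : ℂ))
          fun i hi => by simp [hzero i hi]]
        simpa only [Complex.real_smul] using h0)
    refine subset_convexHull ℝ _ ⟨ϑ, ?_⟩
    change ∫ u, F u ∂(ϑ.measure : Measure UnitCircle) = B a
    rw [hϑ, ProbabilityMeasure.integral_ofWeights _ _ hF.stronglyMeasurable]
    refine (Fintype.sum_subtype_of_eq_zero (fun i => 0 < a i) (fun i => a i • F (x i))
      fun i hi => by simp [hzero i hi]).trans ?_
    simp [B, Fintype.linearCombination_apply]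
  have hsub : P ⊆ B ⁻¹' K := by
    rw [← closure_convexHull_extremePoints hPc hPconv]
    exact closure_minimal (convexHull_min hext ((convex_convexHull ℝ _).linear_preimage B))
      ((isCompact_convexHull_range hF).isClosed.preimage B.continuous_of_finiteDimensional)
  have := hsub (show c.1 ∈ P from ⟨c.2, h0⟩)
  simpa [B, Fintype.linearCombination_apply] using this

theorem integral_mem_convexHull_range {Ω : Type*} [MeasurableSpace Ω] {P : Measure Ω}
    [IsProbabilityMeasure P] {g : Ω → UnitCircle} (hg : Measurable g)
    (h0 : ∫ ω, (g ω : ℂ) ∂P = 0) {F : UnitCircle → V} (hF : Continuous F) :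
    ∫ ω, F (g ω) ∂P ∈ convexHull ℝ
      (Set.range fun ϑ : ThetaHat => ∫ u, F u ∂(ϑ.measure : Measure UnitCircle)) := by
  have : CompleteSpace V := FiniteDimensional.complete ℝ V
  -- Carrying the position along with `F` ensures that the finite combination representing the
  -- integral again has mean zero.
  let G : UnitCircle → V × ℂ := fun u => (F u, (u : ℂ))
  have hG : Continuous G := hF.prodMk continuous_subtype_val
  have hmem := (convex_convexHull ℝ (Set.range G)).integral_mem
    (isCompact_range hG).convexHull_of_finiteDimensional.isClosed
    (Filter.Eventually.of_forall fun ω => subset_convexHull ℝ _ ⟨g ω, rfl⟩) (hG.integrable_comp_of_compactSpace (P := P) hg)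
  obtain ⟨ι, _, c, z, hc, hc1, hz, hsum⟩ := mem_convexHull_iff_exists_fintype.1 hmem
  choose x hx using hz
  have hpair : ∫ ω, G (g ω) ∂P = (∫ ω, F (g ω) ∂P, 0) := by
    rw [← h0]
    exact integral_pair (hF.integrable_comp_of_compactSpace hg)
      (continuous_subtype_val.integrable_comp_of_compactSpace hg)
  rw [hpair] at hsum
  have h1 := congrArg Prod.fst hsum
  have h2 := congrArg Prod.snd hsum
  simp only [Prod.fst_sum, Prod.snd_sum, ← hx, G, Prod.smul_mk] at h1 h2
  rw [← h1]
  exact sum_smul_mem_convexHull_range hF ⟨c, hc, hc1⟩ x h2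

end ThetaHat

/-! ### Herglotz formula and first moment on the circle -/

section
open Complex Metric Real

theorem mul_conj_eq_one_of_mem_sphere {w : ℂ} (hw : w ∈ sphere (0 : ℂ) |(1 : ℝ)|) :
    w * (starRingEnd ℂ) w = 1 := by
  have : ‖w‖ = 1 := by simpa using hw
  rw [Complex.mul_conj, Complex.normSq_eq_norm_sq, this]
  simp

theorem Real.circleAverage_conj (F : ℂ → ℂ) (c : ℂ) (R : ℝ) :
    circleAverage (fun w => (starRingEnd ℂ) (F w)) c R = (starRingEnd ℂ) (circleAverage F c R) := by
  simp only [circleAverage_def, intervalIntegral.intervalIntegral_eq_integral_uIoc,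
    integral_conj]
  simp [Complex.real_smul, Real.pi_pos.le, Complex.conj_ofNat]

theorem Real.circleAverage_add_of_continuousOn (G H : ℂ → ℂ) {c : ℂ} {R : ℝ}
    (hG : ContinuousOn G (sphere c |R|)) (hH : ContinuousOn H (sphere c |R|)) :
    circleAverage G c R + circleAverage H c R = circleAverage (fun w => G w + H w) c R :=
  (circleAverage_add hG.circleIntegrable' hH.circleIntegrable').symm

theorem herglotzRieszKernel_eq (z w : ℂ) : herglotzRieszKernel 0 z w = (w + z) / (w - z) := by
  simp [herglotzRieszKernel_def]

/-- The Herglotz formula on the unit circle for a function that is real at the origin. -/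
theorem circleAverage_re_smul_herglotzKernel_of_diffContOnCl {F : ℂ → ℂ}
    (hF : DiffContOnCl ℂ F (ball 0 1)) (h0 : (F 0).im = 0) {z : ℂ} (hz : z ∈ ball (0 : ℂ) 1) :
    circleAverage (fun w => (F w).re • ((w + z) / (w - z))) 0 1 = F z := by
  have hz1 : ‖z‖ < 1 := by simpa using hz
  have hFc : ContinuousOn F (sphere 0 |1|) := by
    refine hF.continuousOn_ball.mono ?_
    simpa using sphere_subset_closedBall
  have hKc : ContinuousOn (fun w : ℂ => (w + z) / (w - z)) (sphere 0 |1|) := by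
    refine ContinuousOn.div (by fun_prop) (by fun_prop) fun w hw h => ?_
    have : ‖w‖ = 1 := by simpa using hw
    rw [sub_eq_zero.1 h] at this
    exact hz1.ne this
  have hcK : ContinuousOn (fun w : ℂ => (starRingEnd ℂ) ((w + z) / (w - z))) (sphere 0 |1|) :=
    Complex.continuous_conj.comp_continuousOn hKc
  have hcF : ContinuousOn (fun w : ℂ => (starRingEnd ℂ) (F w)) (sphere 0 |1|) :=
    Complex.continuous_conj.comp_continuousOn hFc
  -- the conjugate kernel agrees on the circle with a function analytic in the disc
  have h1 : circleAverage (fun w => (starRingEnd ℂ) ((w + z) / (w - z)) * F w) 0 1 = F 0 := by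
    have hden : ∀ w ∈ closedBall (0 : ℂ) 1, 1 - (starRingEnd ℂ) z * w ≠ 0 := by
      intro w hw h
      have hw1 : ‖w‖ ≤ 1 := by simpa using hw
      have : ‖(starRingEnd ℂ) z * w‖ = 1 := by rw [← sub_eq_zero.1 h]; simp
      rw [norm_mul, RCLike.norm_conj] at this
      nlinarith [norm_nonneg z, norm_nonneg w]
    have hG : DiffContOnCl ℂ (fun w : ℂ => ((1 + (starRingEnd ℂ) z * w) /
        (1 - (starRingEnd ℂ) z * w)) • F w) (ball 0 1) := by
      refine DiffContOnCl.smul (DifferentiableOn.diffContOnCl ?_) hF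
      rw [closure_ball _ one_ne_zero]
      exact DifferentiableOn.div (by fun_prop) (by fun_prop) hden
    have := DiffContOnCl.circleAverage (R := 1) (by simpa using hG)
    simp only [mul_zero, add_zero, sub_zero, div_one, one_mul] at this
    rw [← this]
    refine circleAverage_congr_sphere fun w hw => ?_
    have hww := mul_conj_eq_one_of_mem_sphere hw
    have hw0 : w ≠ 0 := left_ne_zero_of_mul_eq_one hww
    have hden' := hden w (by simpa using sphere_subset_closedBall hw)
    have hcw : (starRingEnd ℂ) w = w⁻¹ := eq_inv_of_mul_eq_one_right hww
    have hden2 : w⁻¹ - (starRingEnd ℂ) z ≠ 0 := by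
      intro h
      apply hden'
      rw [← sub_eq_zero.1 h, inv_mul_cancel₀ hw0, sub_self]
    simp only [map_div₀, map_add, map_sub, hcw]
    congr 1
    field_simp
  have h2 : circleAverage (fun w => ((w + z) / (w - z)) * (starRingEnd ℂ) (F w)) 0 1 = F 0 := by
    have := Real.circleAverage_conj (fun w => (starRingEnd ℂ) ((w + z) / (w - z)) * F w) 0 1
    simp only [map_mul, Complex.conj_conj] at this
    rw [this, h1, Complex.conj_eq_iff_im.2 h0]
  -- The kernel plus its conjugate is twice the Poisson kernel.
  have h3 : circleAverage (fun w => ((w + z) / (w - z)) * F w) 0 1 +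
      circleAverage (fun w => (starRingEnd ℂ) ((w + z) / (w - z)) * F w) 0 1 = 2 * F z := by
    have hp := hF.circleAverage_re_herglotzRieszKernel_smul hz
    rw [circleAverage_add_of_continuousOn _ _ (hKc.fun_mul hFc) (hcK.fun_mul hFc), ← hp, ← smul_eq_mul,
      ← circleAverage_smul]
    refine circleAverage_congr_sphere fun w _ => ?_
    simp only [Pi.smul_apply, Pi.smul_apply', Function.comp_apply,
      herglotzRieszKernel_eq, smul_eq_mul, Complex.real_smul, Complex.re_eq_add_conj]
    ring
  -- Since 2 Re F = F + conj F, the average is (2F(z) − F(0)) + F(0).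
  have h4 : circleAverage (fun w => (2 : ℂ) • ((F w).re • ((w + z) / (w - z)))) 0 1 = 2 * F z := by
    rw [← h3, h1, ← h2, circleAverage_add_of_continuousOn _ _ (hKc.fun_mul hFc) (hKc.fun_mul hcF)]
    refine circleAverage_congr_sphere fun w _ => ?_
    simp only [smul_eq_mul, Complex.real_smul, Complex.re_eq_add_conj]
    ring
  rw [show (fun w => (2 : ℂ) • ((F w).re • ((w + z) / (w - z)))) =
    (2 : ℂ) • fun w => ((F w).re • ((w + z) / (w - z))) from rfl, circleAverage_smul,
    smul_eq_mul] at h4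
  exact mul_left_cancel₀ two_ne_zero h4

/-- Write 2w Re F = wF + w·conj F. The first term has average 0 by the mean value property; the
second averages to the conjugate of F'(0). -/
theorem circleAverage_re_smul_id_of_differentiableOn {F : ℂ → ℂ}
    (hF : DifferentiableOn ℂ F (closedBall 0 1)) (h0 : deriv F 0 = 0) :
    circleAverage (fun w => (F w).re • w) 0 1 = 0 := by
  have hsub : sphere (0 : ℂ) |1| ⊆ closedBall 0 1 := by simpa using sphere_subset_closedBall
  have hFc : ContinuousOn F (sphere 0 |1|) := hF.continuousOn.mono hsub
  have hcF : ContinuousOn (fun w : ℂ => (starRingEnd ℂ) (F w)) (sphere 0 |1|) :=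
    Complex.continuous_conj.comp_continuousOn hFc
  have h1 : circleAverage (fun w => w • F w) 0 1 = 0 := by
    have : DiffContOnCl ℂ (fun w => w • F w) (ball 0 |1|) := by
      refine DifferentiableOn.diffContOnCl ?_
      rw [closure_ball _ (by simp), abs_one]
      exact differentiableOn_id.smul hF
    simpa using DiffContOnCl.circleAverage this
  have h2 : circleAverage (fun w => (starRingEnd ℂ) w * F w) 0 1 = 0 := by
    have hD : DifferentiableOn ℂ (dslope F 0) (closedBall 0 1) :=
      (Complex.differentiableOn_dslope (closedBall_mem_nhds _ one_pos)).2 hF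
    have hG : DiffContOnCl ℂ (dslope F 0) (ball 0 |1|) := by
      refine DifferentiableOn.diffContOnCl ?_
      rwa [closure_ball _ (by simp), abs_one]
    have hA : circleAverage (dslope F 0) 0 1 = 0 := by
      rw [DiffContOnCl.circleAverage hG, dslope_same, h0]
    have hB : circleAverage (fun w => (starRingEnd ℂ) w * F 0) 0 1 = 0 := by
      have h : circleAverage (fun w : ℂ => w * (starRingEnd ℂ) (F 0)) 0 1 = 0 := by
        have : DiffContOnCl ℂ (fun w : ℂ => w * (starRingEnd ℂ) (F 0)) (ball 0 |1|) :=
          Differentiable.diffContOnCl (by fun_prop)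
        simpa using DiffContOnCl.circleAverage this
      have := Real.circleAverage_conj (fun w : ℂ => w * (starRingEnd ℂ) (F 0)) 0 1
      simpa [h] using this
    -- On the circle conj(w)·F(w) = (F(w) − F(0))/w + conj(w)·F(0).
    have hsum := circleAverage_add_of_continuousOn _ _ (hD.continuousOn.mono hsub)
      (Complex.continuous_conj.continuousOn.fun_mul (continuousOn_const (c := F 0)))
    rw [hA, hB, add_zero] at hsum
    refine (circleAverage_congr_sphere fun w hw => ?_).trans hsum.symm
    have hww := mul_conj_eq_one_of_mem_sphere hw
    have hw0 : w ≠ 0 := left_ne_zero_of_mul_eq_one hww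
    have hcw : (starRingEnd ℂ) w = w⁻¹ := eq_inv_of_mul_eq_one_right hww
    simp only [dslope_of_ne _ hw0, slope_def_field, hcw]
    field_simp
    ring
  have h3 : circleAverage (fun w => w * (starRingEnd ℂ) (F w)) 0 1 = 0 := by
    have := Real.circleAverage_conj (fun w => (starRingEnd ℂ) w * F w) 0 1
    simpa [h2] using this
  have h4 : circleAverage (fun w => (2 : ℂ) • ((F w).re • w)) 0 1 = 0 := by
    have := circleAverage_add_of_continuousOn _ _ (continuousOn_id.fun_smul hFc) (continuousOn_id.fun_mul hcF)
    simp only [id] at this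
    rw [h1, h3, add_zero] at this
    refine (circleAverage_congr_sphere fun w _ => ?_).trans this.symm
    simp only [smul_eq_mul, Complex.real_smul, Complex.re_eq_add_conj]
    ring
  rw [show (fun w => (2 : ℂ) • ((F w).re • w)) = (2 : ℂ) • fun w => ((F w).re • w) from rfl,
    circleAverage_smul, smul_eq_mul] at h4
  exact (mul_eq_zero.1 h4).resolve_left two_ne_zero

end

/-! ### From finitely many points to the whole disc -/

theorem continuous_add_div_sub {z : ℂ} (hz : z ∈ Metric.ball (0 : ℂ) 1) :
    Continuous fun w : UnitCircle => ((w : ℂ) + z) / ((w : ℂ) - z) := by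
  refine Continuous.div (by fun_prop) (by fun_prop) fun w h => ?_
  have h1 : ‖(w : ℂ)‖ = 1 := by simp
  have h2 : ‖z‖ < 1 := by simpa using hz
  rw [sub_eq_zero.1 h] at h1
  exact h2.ne h1

namespace ThetaHat

theorem continuous_herglotz {z : ℂ} (hz : z ∈ Metric.ball (0 : ℂ) 1) :
    Continuous fun ϑ : ThetaHat => ϑ.herglotz z :=
  continuous_integral_measure (continuous_add_div_sub hz)

/-- The values of a function with positive real part at finitely many points of the disc, for a
function holomorphic on the closed disc. -/
theorem mem_convexHull_range_herglotz_of_differentiableOn_closedBall {F : ℂ → ℂ}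
    (hF : DifferentiableOn ℂ F (Metric.closedBall 0 1))
    (hre : ∀ z ∈ Metric.closedBall (0 : ℂ) 1, 0 < (F z).re) (hderiv : deriv F 0 = 0)
    (h0 : F 0 = 1) (Z : Finset (Metric.ball (0 : ℂ) 1)) :
    (fun z : Z => F z) ∈
      convexHull ℝ (Set.range fun (ϑ : ThetaHat) (z : Z) => ϑ.herglotz z) := by
  have hd : DiffContOnCl ℂ F (Metric.ball 0 1) := by
    refine DifferentiableOn.diffContOnCl ?_
    rwa [closure_ball _ one_ne_zero]
  let g : ℝ → UnitCircle := fun t => ⟨circleMap 0 1 t, by simp⟩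
  have hg : Continuous g := (continuous_circleMap 0 1).subtype_mk _
  let ρ : ℝ → ℝ := fun t => (2 * Real.pi)⁻¹ * (F (circleMap 0 1 t)).re
  have hρ : Continuous ρ := by
    refine continuous_const.mul (Complex.continuous_re.comp ?_)
    exact hF.continuousOn.comp_continuous (continuous_circleMap 0 1) fun t => by simp
  have hρ0 : ∀ t, 0 ≤ ρ t := fun t =>
    mul_nonneg (by positivity) (hre _ (by simp)).le
  let P : Measure ℝ := (volume.restrict (Set.Ioc 0 (2 * Real.pi))).withDensity
    fun t => ENNReal.ofReal (ρ t)
  have hP : ∀ {V : Type} [NormedAddCommGroup V] [NormedSpace ℝ V] (G : ℂ → V),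
      ∫ t, G (g t) ∂P = Real.circleAverage (fun w => (F w).re • G w) 0 1 := by
    intro V _ _ G
    rw [integral_withDensity_eq_integral_toReal_smul (by fun_prop)
      (Filter.Eventually.of_forall fun t => ENNReal.ofReal_lt_top), Real.circleAverage_def,
      intervalIntegral.integral_of_le (by positivity), ← integral_smul]
    refine integral_congr_ae (Filter.Eventually.of_forall fun t => ?_)
    simp only [ENNReal.toReal_ofReal (hρ0 t), ρ, mul_smul, g]
  have hfin : IsFiniteMeasure P := by
    refine isFiniteMeasure_withDensity_ofReal ?_
    exact (hρ.integrableOn_Icc.mono_set Set.Ioc_subset_Icc_self).2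
  -- The total mass is the Herglotz formula at z = 0, where the kernel is 1.
  have hprob : IsProbabilityMeasure P := by
    have h1 := circleAverage_re_smul_herglotzKernel_of_diffContOnCl hd (by simp [h0])
      (Metric.mem_ball_self one_pos)
    rw [← hP fun w => (w + 0) / (w - 0), h0] at h1
    have hone : ∀ t, ((g t : ℂ) + 0) / ((g t : ℂ) - 0) = 1 := fun t => by
      have : (g t : ℂ) ≠ 0 := ne_of_mem_of_not_mem (g t).2 (by simp)
      simp [this]
    simp only [hone, integral_const, Complex.real_smul, mul_one] at h1
    have h2 : P.real Set.univ = 1 := by exact_mod_cast h1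
    refine ⟨?_⟩
    rwa [Measure.real, ENNReal.toReal_eq_one_iff] at h2
  let Φ : UnitCircle → Z → ℂ := fun u z => ((u : ℂ) + z) / ((u : ℂ) - z)
  have hΦ : Continuous Φ := continuous_pi fun z => continuous_add_div_sub z.1.2
  have hmean : ∫ t, (g t : ℂ) ∂P = 0 := by
    rw [hP fun w => w, circleAverage_re_smul_id_of_differentiableOn hF hderiv]
  have hmem := integral_mem_convexHull_range hg.measurable hmean hΦ
  have hpi : ∀ {Ω : Type} [MeasurableSpace Ω] (Q : Measure Ω) [IsFiniteMeasure Q]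
      (k : Ω → UnitCircle), Measurable k →
      ∫ ω, Φ (k ω) ∂Q = fun z : Z => ∫ ω, ((k ω : ℂ) + z) / ((k ω : ℂ) - z) ∂Q := by
    intro Ω _ Q _ k hk
    funext z
    exact eval_integral (fun z' : Z =>
      (continuous_add_div_sub z'.1.2).integrable_comp_of_compactSpace hk) z
  have hval : ∫ t, Φ (g t) ∂P = fun z : Z => F z := by
    rw [hpi P g hg.measurable]
    funext z
    rw [hP fun w => (w + z) / (w - z)]
    exact circleAverage_re_smul_herglotzKernel_of_diffContOnCl hd (by simp [h0]) z.1.2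
  have hrange : (fun ϑ : ThetaHat => ∫ u, Φ u ∂(ϑ.measure : Measure UnitCircle)) =
      fun (ϑ : ThetaHat) (z : Z) => ϑ.herglotz z :=
    funext fun ϑ => hpi (ϑ.measure : Measure UnitCircle) id measurable_id
  rwa [hval, hrange] at hmem

/-- The dilations f(r·), 0 < r < 1, are holomorphic on the closed disc and converge to f on `Z` as r
→ 1; the hull is closed. -/
theorem mem_convexHull_range_herglotz {f : ℂ → ℂ} (hf : DifferentiableOn ℂ f (Metric.ball 0 1))
    (hre : ∀ z ∈ Metric.ball (0 : ℂ) 1, 0 < (f z).re) (hderiv : deriv f 0 = 0)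
    (h0 : f 0 = 1) (Z : Finset (Metric.ball (0 : ℂ) 1)) :
    (fun z : Z => f z) ∈
      convexHull ℝ (Set.range fun (ϑ : ThetaHat) (z : Z) => ϑ.herglotz z) := by
  have hcomp : IsCompact
      (convexHull ℝ (Set.range fun (ϑ : ThetaHat) (z : Z) => ϑ.herglotz z)) :=
    (isCompact_range (continuous_pi fun z => continuous_herglotz z.1.2)
      ).convexHull_of_finiteDimensional
  have hlim : Filter.Tendsto (fun (r : ℝ) (z : Z) => f (r * z)) (nhdsWithin 1 (Set.Iio 1))
      (nhds fun z : Z => f z) := by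
    refine tendsto_pi_nhds.2 fun z => Filter.Tendsto.mono_left ?_ nhdsWithin_le_nhds
    have h1 : ContinuousAt f z :=
      hf.continuousOn.continuousAt (Metric.isOpen_ball.mem_nhds z.1.2)
    have h2 : Filter.Tendsto (fun r : ℝ => (r : ℂ) * z) (nhds 1) (nhds z) := by
      have : Continuous fun r : ℝ => (r : ℂ) * (z : ℂ) := by fun_prop
      simpa using this.tendsto 1
    exact h1.tendsto.comp h2
  refine hcomp.isClosed.mem_of_tendsto hlim ?_
  filter_upwards [Ioo_mem_nhdsLT (zero_lt_one' ℝ)] with r hr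
  have hmaps : Set.MapsTo (fun z : ℂ => (r : ℂ) * z) (Metric.closedBall 0 1)
      (Metric.ball 0 1) := by
    intro z hz
    have hz1 : ‖z‖ ≤ 1 := by simpa using hz
    have : ‖(r : ℂ) * z‖ = r * ‖z‖ := by simp [abs_of_pos hr.1]
    rw [mem_ball_zero_iff, this]
    nlinarith [hr.1, hr.2, norm_nonneg z]
  refine mem_convexHull_range_herglotz_of_differentiableOn_closedBall
    (F := fun z => f (r * z)) (hf.comp (by fun_prop) hmaps) (fun z hz => hre _ (hmaps hz)) ?_
    (by simp [h0]) Z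
  rw [deriv_comp_mul_left]
  simp [hderiv]

/-- Each z imposes a closed condition on ν, and finitely many are met by a finitely supported
measure; compactness meets all at once. -/
theorem exists_probabilityMeasure_integral_herglotz_eq {φ : ℂ → ℂ}
    (h : ∀ Z : Finset (Metric.ball (0 : ℂ) 1), (fun z : Z => φ z) ∈
      convexHull ℝ (Set.range fun (ϑ : ThetaHat) (z : Z) => ϑ.herglotz z)) :
    ∃ ν : ProbabilityMeasure ThetaHat, ∀ z ∈ Metric.ball (0 : ℂ) 1,
      ∫ ϑ : ThetaHat, ϑ.herglotz z ∂(ν : Measure ThetaHat) = φ z := by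
  let K : Metric.ball (0 : ℂ) 1 → Set (ProbabilityMeasure ThetaHat) := fun z =>
    {ν | ∫ ϑ : ThetaHat, ϑ.herglotz z ∂(ν : Measure ThetaHat) = φ z}
  have hK : ∀ z, IsClosed (K z) := fun z =>
    isClosed_eq (ProbabilityMeasure.continuous_integral (continuous_herglotz z.2))
      continuous_const
  obtain ⟨ν, hν⟩ := CompactSpace.iInter_nonempty hK fun Z => by
    obtain ⟨ι, _, c, y, hc, hc1, hy, hsum⟩ := mem_convexHull_iff_exists_fintype.1 (h Z)
    choose ϑ hϑ using hy
    refine ⟨ProbabilityMeasure.ofWeights ⟨c, hc, hc1⟩ ϑ, Set.mem_iInter₂.2 fun z hz => ?_⟩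
    change ∫ ϑ : ThetaHat, ϑ.herglotz z ∂_ = φ z
    rw [ProbabilityMeasure.integral_ofWeights _ _ (continuous_herglotz z.2).stronglyMeasurable]
    have := congrFun hsum ⟨z, hz⟩
    simpa [← hϑ] using this
  exact ⟨ν, fun z hz => Set.mem_iInter.1 hν ⟨z, hz⟩⟩

end ThetaHat

theorem mainTheorem3 (f : ℂ → ℂ)
    (hf : AnalyticOnNhd ℂ f (Metric.ball 0 1))
    (hre : ∀ z ∈ Metric.ball (0 : ℂ) 1, 0 < (f z).re)
    (hderiv : deriv f 0 = 0)
    (h0 : 0 < f 0) :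
    ∃ ν : Measure ThetaHat, IsFiniteMeasure ν ∧
      ∀ z ∈ Metric.ball (0 : ℂ) 1,
        Integrable (fun ϑ : ThetaHat => ϑ.herglotz z) ν ∧
        f z = ∫ ϑ : ThetaHat, ϑ.herglotz z ∂ν := by
  obtain ⟨hm, him⟩ := Complex.pos_iff.1 h0
  set m : ℝ := (f 0).re with hm_def
  have hfm : f 0 = m := Complex.ext (by simp [hm_def]) (by simp [← him])
  -- Dividing by m = f(0) normalizes the value at 0; the factor returns as the total mass of the
  -- final measure.
  obtain ⟨ν, hν⟩ := ThetaHat.exists_probabilityMeasure_integral_herglotz_eq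
    (φ := fun z => m⁻¹ • f z) (ThetaHat.mem_convexHull_range_herglotz (f := fun z => m⁻¹ • f z)
      (hf.differentiableOn.fun_const_smul _)
      (fun z hz => by simpa using mul_pos (inv_pos.2 hm) (hre z hz))
      (by rw [deriv_fun_const_smul _ (hf 0 (by simp)).differentiableAt, hderiv, smul_zero])
      (by simp [hfm, hm.ne']))
  refine ⟨ENNReal.ofReal m • (ν : Measure ThetaHat),
    Measure.smul_finite _ ENNReal.ofReal_ne_top, fun z hz => ⟨?_, ?_⟩⟩
  · exact Integrable.smul_measure ((ThetaHat.continuous_herglotz hz).integrable_comp_of_compactSpace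
      measurable_id) ENNReal.ofReal_ne_top
  · rw [integral_smul_measure, hν z hz, ENNReal.toReal_ofReal hm.le, smul_inv_smul₀ hm.ne']
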